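/- **Setting.** Let $n\ge 1$ and $k=\lceil\log_2 n\rceil$. The SOS2 constraint $\mathcal P=(P^i)_{i=1}^n$ on the simplex $\Delta^{n+1}=\{\lambda\in\mathbb R^{n+1}_+ : \sum_{j=1}^{n+1}\lambda_j=1\}$ is the family $P^i=\{\lambda\in\Delta^{n+1} : \lambda_j\le 0\ \ \forall j\notin\{i,i+1\}\}$. A Gray code is a family $H=(h^i)_{i=1}^n$ of pairwise distinct vectors $h^i\in\{0,1\}^k$ with $\sum_{l=1}^k|h^i_l-h^{i+1}_l|=1$ for all $i\in\{1,\dots,n-1\}$. Put $Q(\mathcal P,H)=\operatorname{conv}\bigl(\bigcup_{i=1}^n P^i\times\{h^i\}\bigr)\subseteq\mathbb R^{n+1}\times\mathbb R^k$, $h^0=h^1$, $h^{n+1}=h^n$, $c^i=h^{i+1}-h^i$ for $1\le i\le n-1$, and $L(H)=\operatorname{aff}(H)-h^1$, $\dim(H)=\dim L(H)$. For a polyhedron $Q$ let $\operatorname{size}(Q)$ be the minimum number of linear inequalities needed to describe $Q$ (an equation counts as two inequalities). Let $\operatorname{size}_G(Q(\mathcal P,H))$ be twice the number of linear hyperplanes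 of $L(H)$ that are spanned by subfamilies of $(c^i)_{i=1}^{n-1}$, and let $\operatorname{size}_B(Q(\mathcal P,H))=|J|$, where $J=\{1,n+1\}\cup\{j\in\{2,\dots,n\} : L(H)=\operatorname{span}\{c^i : 1\le i\le n-1,\ i\ne j-1\}\}$. **Corollary.** Let $H$ be a Gray code. Then $(\lambda,y)\in Q(\mathcal P,H)$ if and only if $$\sum_{j=1}^{n+1}\lambda_j=1,\tag{1}$$ $$\sum_{j=1}^{n+1}\min\{h^j_l,h^{j-1}_l\}\lambda_j\ \le\ y_l\ \le\ \sum_{j=1}^{n+1}\max\{h^j_l,h^{j-1}_l\}\lambda_j\qquad\forall l\in\{1,\dots,k\},\tag{2}$$ $$\lambda_j\ge 0\qquad\forall j\in\{1,\dots,n+1\}.\tag{3}$$ Furthermore, all inequalities in (2) are facet defining for $Q(\mathcal P,H)$, and $\operatorname{size}_G(Q(\mathcal P,H))=2\lceil\log_2 n\rceil$. In addition, at least $n-1$ of the inequalities in (3) are facet defining, $\operatorname{size}_B(Q(\mathcal P,H))$ is the number of inequalities in (3) that are facet defining, $\operatorname{size}(Q(\mathcal P,H))=\operatorname{size}_G(Q(\mathcal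 P,H))+\operatorname{size}_B(Q(\mathcal P,H))+2(1+k-\dim(H))$, and $$\bigl|\operatorname{size}_B(Q(\mathcal P,H))-n\bigr|\le 1,\qquad \bigl|\operatorname{size}(Q(\mathcal P,H))-(2\lceil\log_2 n\rceil+n+2)\bigr|\le 1.$$ Finally, these last two bounds are tight: there are some $n\ge 2$ and a Gray code $H$ for which both differences inside the absolute values equal $1$, and some $n\ge 2$ and a Gray code $H$ for which both equal $-1$. -/

import Mathlib

open scoped BigOperators

noncomputable section

namespace EmbeddingForm

/-- The embedding `Q(P, H)`: the convex hull of the union of the sets `Pⁱ × {hⁱ}`. -/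
def embedding {ι E F : Type*} [AddCommGroup E] [Module ℝ E] [AddCommGroup F] [Module ℝ F]
    (P : ι → Set E) (h : ι → F) : Set (E × F) :=
  convexHull ℝ (⋃ i, P i ×ˢ {h i})

/-- The SOS2 constraint on the standard simplex of `ℝⁿ⁺¹`: the `i`-th polyhedron consists of the
points of the simplex whose coordinates vanish outside the two adjacent positions `i`, `i + 1`. -/
def sos2 (n : ℕ) (i : Fin n) : Set (Fin (n + 1) → ℝ) :=
  {lam | lam ∈ stdSimplex ℝ (Fin (n + 1)) ∧ ∀ j, j ≠ i.castSucc → j ≠ i.succ → lam j ≤ 0}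

/-- An encoding: a family of `n` pairwise distinct `0`-`1` vectors with `k` components. -/
def IsEncoding {n k : ℕ} (h : Fin n → Fin k → ℝ) : Prop :=
  (∀ i l, h i l = 0 ∨ h i l = 1) ∧ Function.Injective h

/-- A Gray code: an encoding with `⌈log₂ n⌉` bits in which exactly one bit changes between
consecutive vectors. -/
def IsGrayCode {n : ℕ} (h : Fin n → Fin (Nat.clog 2 n) → ℝ) : Prop :=
  IsEncoding h ∧
    ∀ (i : ℕ) (hi : i + 1 < n), ∑ l, |h ⟨i, by omega⟩ l - h ⟨i + 1, hi⟩ l| = 1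

/-- The vector `hᵐ` in the usual numbering `h¹, …, hⁿ` (the entry `h ⟨m - 1, _⟩` of the
zero-based family), extended by `h⁰ = h¹` and `hⁿ⁺¹ = hⁿ`. -/
def code {α : Type*} {n : ℕ} (hn : 0 < n) (h : Fin n → α) (m : ℕ) : α :=
  h ⟨min (m - 1) (n - 1), by omega⟩

/-- The difference `cⁱ = hⁱ⁺¹ - hⁱ`. -/
def step {n k : ℕ} (hn : 0 < n) (h : Fin n → Fin k → ℝ) (i : ℕ) : Fin k → ℝ :=
  code hn h (i + 1) - code hn h i

/-- `L(H)`: the linear space parallel to the affine hull of the encoding. -/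
def encSpace {n k : ℕ} (h : Fin n → Fin k → ℝ) : Submodule ℝ (Fin k → ℝ) :=
  vectorSpan ℝ (Set.range h)

/-- The linear hyperplanes of `L(H)` that are spanned by subfamilies of `c¹, …, cⁿ⁻¹`. -/
def spannedHyperplanes {n k : ℕ} (hn : 0 < n) (h : Fin n → Fin k → ℝ) :
    Set (Submodule ℝ (Fin k → ℝ)) :=
  {W | W ≤ encSpace h ∧ Module.finrank ℝ W + 1 = Module.finrank ℝ (encSpace h) ∧
    ∃ I : Set ℕ, I ⊆ Set.Icc 1 (n - 1) ∧ W = Submodule.span ℝ (step hn h '' I)}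

/-- The set `J ⊆ {1, …, n + 1}`: the two ends, and those `j ∈ {2, …, n}` for which the differences
other than `cʲ⁻¹` still span `L(H)`. -/
def boundIndices {n k : ℕ} (hn : 0 < n) (h : Fin n → Fin k → ℝ) : Set ℕ :=
  {1, n + 1} ∪
    {j | j ∈ Set.Icc 2 n ∧
      encSpace h = Submodule.span ℝ (step hn h '' (Set.Icc 1 (n - 1) \ {j - 1}))}

/-- `size_G`: the number of general inequalities, two for each hyperplane of `L(H)` spanned by the
differences. -/
def sizeG {n k : ℕ} (hn : 0 < n) (h : Fin n → Fin k → ℝ) : ℕ :=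
  2 * (spannedHyperplanes hn h).ncard

/-- `size_B`: the number of variable bounds `0 ≤ λ_j`, `j ∈ J`. -/
def sizeB {n k : ℕ} (hn : 0 < n) (h : Fin n → Fin k → ℝ) : ℕ :=
  (boundIndices hn h).ncard

/-- The size of a polyhedron: the least number of linear inequalities that describe it. An equation
has to be written as two inequalities. -/
def polySize {V : Type*} [AddCommGroup V] [Module ℝ V] (Q : Set V) : ℕ :=
  sInf {m : ℕ | ∃ (a : Fin m → Module.Dual ℝ V) (β : Fin m → ℝ), Q = {x | ∀ i, a i x ≤ β i}}

/-- A facet: a nonempty exposed face whose dimension is one less than that of `Q`. -/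
def IsFacet {V : Type*} [AddCommGroup V] [Module ℝ V] [TopologicalSpace V] (Q F : Set V) : Prop :=
  IsExposed ℝ Q F ∧ F.Nonempty ∧
    Module.finrank ℝ (vectorSpan ℝ F) + 1 = Module.finrank ℝ (vectorSpan ℝ Q)

/-- The inequality `f x ≤ g x` is facet defining for `Q`: it is valid on `Q` and it holds with
equality exactly on a facet. -/
def FacetDefining {V : Type*} [AddCommGroup V] [Module ℝ V] [TopologicalSpace V] (Q : Set V)
    (f g : V → ℝ) : Prop :=
  (∀ x ∈ Q, f x ≤ g x) ∧ IsFacet Q {x | x ∈ Q ∧ f x = g x}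

end EmbeddingForm

end

open EmbeddingForm

/-! Fix `λ` in the simplex. Over a vertex `e_j` the embedding contains the two consecutive code
vectors, and these differ in at most one bit, so every choice of coordinates between them lies on
the segment joining them. Averaging over `j` with weights `λ_j`, and with one ratio `θ_l` per bit
common to all `j`, gives every `y` between the bounds. This is the description (`embedding_eq`).

The two slacks of bit `l` add up to `∑ |step_j l| λ_j` (`lowerForm_add_upperForm`). Call a position
essential if some bit changes there and nowhere else. For such a `j` this sum is `|step_j l| λ_j`,
so the bound `0 ≤ λ_j` is redundant and its face has codimension at least two. All other
inequalities can be made tight one at a time (`irredundant`). For an irredundant system on a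
hyperplane each inequality gives a facet, and the size is the number of inequalities plus two
(`isFacet_coneSlice`, `polySize_coneSlice`).

Since `k` is the least possible number of bits, every bit changes, the nonzero steps are signed unit
vectors meeting every coordinate, and the spanned hyperplanes are the `k` coordinate ones. The same
minimality allows at most two essential positions (`not_three_essential`), so `size_B = n + 1 -
#essential` lies between `n - 1` and `n + 1`. -/

namespace EmbeddingForm

/-! ### Facets and size of an irredundant system on a hyperplane -/

section Polyhedra

variable {V : Type*} [AddCommGroup V] [Module ℝ V] {ι : Type*}

/-- Each condition holds for all small positive `ε`, and there are finitely many of them. This is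
the source of all small moves below. -/
lemma exists_pos_forall_add_mul_nonneg [Finite ι] (p q : ι → ℝ)
    (h : ∀ i, 0 < p i ∨ (0 ≤ p i ∧ 0 ≤ q i)) : ∃ ε > 0, ∀ i, 0 ≤ p i + ε * q i := by
  have key : ∀ᶠ ε in nhdsWithin (0 : ℝ) (Set.Ioi 0), ∀ i, 0 ≤ p i + ε * q i := by
    refine Filter.eventually_all.2 fun i => ?_
    rcases h i with h | ⟨hp, hq⟩
    · have hc : Filter.Tendsto (fun ε : ℝ => p i + ε * q i) (nhds 0) (nhds (p i + 0 * q i)) :=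
        Continuous.tendsto (by fun_prop) 0
      have : ∀ᶠ ε in nhds (0 : ℝ), 0 < p i + ε * q i :=
        hc.eventually (lt_mem_nhds (by simpa using h))
      exact (this.filter_mono nhdsWithin_le_nhds).mono fun _ h => h.le
    · filter_upwards [self_mem_nhdsWithin] with ε hε
      exact add_nonneg hp (mul_nonneg (le_of_lt hε) hq)
  obtain ⟨ε, h1, h2⟩ := (key.and self_mem_nhdsWithin).exists
  exact ⟨ε, h2, h1⟩

/-- The slice at height `1` (with respect to `s`) of the cone of the points where all the linear
forms `g i` are nonnegative. -/
def coneSlice (s : Module.Dual ℝ V) (g : ι → Module.Dual ℝ V) : Set V :=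
  {x | s x = 1 ∧ ∀ i, 0 ≤ g i x}

/-- A system of inequalities `0 ≤ g i x` on the hyperplane `s x = 1` is irredundant: some point
satisfies all of them strictly, and for each `i` some point satisfies the `i`-th one with equality
and all others strictly. -/
structure Irredundant (s : Module.Dual ℝ V) (g : ι → Module.Dual ℝ V) : Prop where
  exists_interior : ∃ x, s x = 1 ∧ ∀ i, 0 < g i x
  exists_tight : ∀ i, ∃ x, s x = 1 ∧ g i x = 0 ∧ ∀ j, j ≠ i → 0 < g j x

variable {s : Module.Dual ℝ V} {g : ι → Module.Dual ℝ V}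

lemma exists_pos_add_smul_mem_coneSlice [Finite ι] {x v : V} (hx : x ∈ coneSlice s g)
    (hv : s v = 0) (h : ∀ i, 0 < g i x ∨ 0 ≤ g i v) : ∃ ε > (0 : ℝ), x + ε • v ∈ coneSlice s g := by
  obtain ⟨ε, hε, H⟩ := exists_pos_forall_add_mul_nonneg (fun i => g i x) (fun i => g i v)
    fun i => (h i).imp_right fun h => ⟨hx.2 i, h⟩
  exact ⟨ε, hε, by simp [hv, hx.1], fun i => by simpa using H i⟩

lemma mem_vectorSpan_of_add_smul_mem {S : Set V} {x v : V} {ε : ℝ} (hε : 0 < ε) (hx : x ∈ S)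
    (h : x + ε • v ∈ S) : v ∈ vectorSpan ℝ S := by
  have := Submodule.smul_mem _ ε⁻¹ (vsub_mem_vectorSpan ℝ h hx)
  simpa [smul_smul, inv_mul_cancel₀ hε.ne'] using this

lemma vectorSpan_le_ker {S : Set V} {f : Module.Dual ℝ V} {c : ℝ} (h : ∀ x ∈ S, f x = c) :
    vectorSpan ℝ S ≤ LinearMap.ker f := by
  refine Submodule.span_le.2 ?_
  rintro _ ⟨x, hx, y, hy, rfl⟩
  simp [h x hx, h y hy]

/-- At a strictly feasible point every direction in the kernel of `s` can be followed a little way.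
The face version below does the same at a point where only `g i` is tight. -/
lemma vectorSpan_coneSlice [Finite ι] (H : Irredundant s g) :
    vectorSpan ℝ (coneSlice s g) = LinearMap.ker s := by
  refine le_antisymm (vectorSpan_le_ker fun x hx => hx.1) fun v hv => ?_
  obtain ⟨x, hx, hg⟩ := H.exists_interior
  have hx' : x ∈ coneSlice s g := ⟨hx, fun i => (hg i).le⟩
  obtain ⟨ε, hε, h⟩ := exists_pos_add_smul_mem_coneSlice hx' hv fun i => Or.inl (hg i)
  exact mem_vectorSpan_of_add_smul_mem hε hx' h

lemma vectorSpan_coneSlice_face [Finite ι] (H : Irredundant s g) (i : ι) :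
    vectorSpan ℝ {x | x ∈ coneSlice s g ∧ g i x = 0} = LinearMap.ker s ⊓ LinearMap.ker (g i) := by
  refine le_antisymm (le_inf (vectorSpan_le_ker fun x hx => hx.1.1)
    (vectorSpan_le_ker fun x hx => hx.2)) ?_
  rintro v ⟨hv, hvi⟩
  obtain ⟨x, hx, hi, hg⟩ := H.exists_tight i
  have hx' : x ∈ coneSlice s g := ⟨hx, fun j => by
    by_cases h : j = i
    · rw [h, hi]
    · exact (hg j h).le⟩
  obtain ⟨ε, hε, h⟩ := exists_pos_add_smul_mem_coneSlice hx' hv fun j => by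
    by_cases h : j = i
    · exact Or.inr (h ▸ (LinearMap.mem_ker.1 hvi).ge)
    · exact Or.inl (hg j h)
  refine mem_vectorSpan_of_add_smul_mem hε ⟨hx', hi⟩ ⟨h, ?_⟩
  simp [hi, LinearMap.mem_ker.1 hvi]

lemma finrank_inf_ker_add_one [FiniteDimensional ℝ V] {S : Submodule ℝ V} {f : Module.Dual ℝ V}
    {v : V} (hv : v ∈ S) (hf : f v ≠ 0) :
    Module.finrank ℝ ↥(S ⊓ LinearMap.ker f) + 1 = Module.finrank ℝ S := by
  have h1 := LinearMap.finrank_range_add_finrank_ker (f.domRestrict S)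
  have h2 : LinearMap.range (f.domRestrict S) = ⊤ :=
    LinearMap.range_eq_top.2 (LinearMap.surjective fun h => hf <| by
      simpa using LinearMap.congr_fun h ⟨v, hv⟩)
  have h3 : S ⊓ LinearMap.ker f = (LinearMap.ker (f.domRestrict S)).map S.subtype := by
    ext w
    simp [and_comm]
  rw [h3, (Submodule.equivMapOfInjective _ S.injective_subtype _).symm.finrank_eq]
  rw [h2] at h1
  simp at h1
  omega

lemma isExposed_setOf_eq_zero [TopologicalSpace V] [IsTopologicalAddGroup V] [ContinuousSMul ℝ V]
    [T2Space V] [FiniteDimensional ℝ V] {Q : Set V} {f : Module.Dual ℝ V} (hf : ∀ x ∈ Q, 0 ≤ f x) :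
    IsExposed ℝ Q {x | x ∈ Q ∧ f x = 0} := by
  -- Exposedness is only required of nonempty faces; the point `z` shows that the maximum of `-f` is
  -- zero.
  rintro ⟨z, hz, hz0⟩
  refine ⟨LinearMap.toContinuousLinearMap (-f), ?_⟩
  ext x
  simp only [Set.mem_ofPred_eq, LinearMap.coe_toContinuousLinearMap', LinearMap.neg_apply,
    neg_le_neg_iff]
  refine and_congr_right fun hx => ⟨fun h y hy => h ▸ hf y hy, fun h => ?_⟩
  exact le_antisymm (hz0 ▸ h z hz) (hf x hx)

lemma isFacet_coneSlice [TopologicalSpace V] [IsTopologicalAddGroup V] [ContinuousSMul ℝ V]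
    [T2Space V] [FiniteDimensional ℝ V] [Finite ι] (H : Irredundant s g) (i : ι) :
    IsFacet (coneSlice s g) {x | x ∈ coneSlice s g ∧ g i x = 0} := by
  obtain ⟨x, hx, hi, hg⟩ := H.exists_tight i
  obtain ⟨z, hz, hzg⟩ := H.exists_interior
  refine ⟨isExposed_setOf_eq_zero fun x hx => hx.2 i, ⟨x, ⟨hx, fun j => ?_⟩, hi⟩, ?_⟩
  · by_cases h : j = i
    · rw [h, hi]
    · exact (hg j h).le
  · rw [vectorSpan_coneSlice_face H, vectorSpan_coneSlice H]
    refine finrank_inf_ker_add_one (v := z - x) (by simp [hx, hz]) ?_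
    simpa [hi] using (hzg i).ne'

/-- A set contained in two different facets is not a facet. -/
lemma not_isFacet_coneSlice [TopologicalSpace V] [FiniteDimensional ℝ V] [Finite ι]
    (H : Irredundant s g) {i i' : ι} (hne : i ≠ i') {F : Set V}
    (hF : ∀ x ∈ F, s x = 1 ∧ g i x = 0 ∧ g i' x = 0) : ¬ IsFacet (coneSlice s g) F := by
  rintro ⟨-, ⟨p, hp⟩, hd⟩
  obtain ⟨x, hx, hi, hg⟩ := H.exists_tight i
  obtain ⟨z, hz, hzg⟩ := H.exists_interior
  -- Each of the two equations lowers the dimension by one: `z - x` leaves the kernel of `g i`, and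
  -- `x - p` stays in it but leaves the kernel of `g i'`.
  have h1 := finrank_inf_ker_add_one (S := LinearMap.ker s) (f := g i) (v := z - x)
    (by simp [hx, hz]) (by simpa [hi] using (hzg i).ne')
  have h2 := finrank_inf_ker_add_one (S := LinearMap.ker s ⊓ LinearMap.ker (g i)) (f := g i')
    (v := x - p) (by simp [hx, (hF p hp).1, hi, (hF p hp).2.1])
    (by simpa [(hF p hp).2.2] using (hg i' hne.symm).ne')
  have h3 : vectorSpan ℝ F ≤ LinearMap.ker s ⊓ LinearMap.ker (g i) ⊓ LinearMap.ker (g i') :=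
    le_inf (le_inf (vectorSpan_le_ker fun x hx => (hF x hx).1)
      (vectorSpan_le_ker fun x hx => (hF x hx).2.1)) (vectorSpan_le_ker fun x hx => (hF x hx).2.2)
  have h4 := Submodule.finrank_mono h3
  rw [vectorSpan_coneSlice H] at hd
  omega

/-- If all points `x + ε • v` with `ε > 0` violate a system of inequalities which `x` satisfies,
then some inequality that is tight at `x` is violated in the direction `v`. -/
lemma exists_tight_of_forall_not_mem {m : ℕ} {a : Fin m → Module.Dual ℝ V} {β : Fin m → ℝ}
    {x v : V} (hx : ∀ i, a i x ≤ β i) (hv : ∀ ε > (0 : ℝ), ¬ ∀ i, a i (x + ε • v) ≤ β i) :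
    ∃ i, a i x = β i ∧ 0 < a i v := by
  by_contra! hcon
  obtain ⟨ε, hε, H⟩ := exists_pos_forall_add_mul_nonneg (fun i => β i - a i x) (fun i => - a i v)
    fun i => by
      rcases (hx i).lt_or_eq with h | h
      · exact Or.inl (sub_pos.2 h)
      · exact Or.inr ⟨sub_nonneg.2 h.le, neg_nonneg.2 (hcon i h)⟩
  refine hv ε hε fun i => ?_
  have := H i
  simp only [map_add, map_smul, smul_eq_mul]
  linarith

/-- Any description needs an inequality `r i` that stops the ray from the interior point `z` through
`p i`. It also needs two inequalities tight at `z` itself, to stop the moves off the hyperplane in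
the directions `z` and `-z`. All of these are distinct. -/
lemma card_add_two_le [Fintype ι] (H : Irredundant s g) {m : ℕ} {a : Fin m → Module.Dual ℝ V}
    {β : Fin m → ℝ} (hQ : coneSlice s g = {x | ∀ i, a i x ≤ β i}) : Fintype.card ι + 2 ≤ m := by
  have hQ' : ∀ x, (∀ i, a i x ≤ β i) ↔ x ∈ coneSlice s g := fun x => by rw [hQ]; rfl
  obtain ⟨z, hz, hzg⟩ := H.exists_interior
  have hzQ : z ∈ coneSlice s g := ⟨hz, fun i => (hzg i).le⟩
  choose p hp hpi hpg using H.exists_tight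
  have hpQ : ∀ i, p i ∈ coneSlice s g := fun i => ⟨hp i, fun j => by
    by_cases h : j = i
    · rw [h, hpi]
    · exact (hpg i j h).le⟩
  have key : ∀ i, ∃ r, a r (p i) = β r ∧ 0 < a r (p i - z) := fun i =>
    exists_tight_of_forall_not_mem ((hQ' _).2 (hpQ i)) fun ε hε hcon => by
      have := ((hQ' _).1 hcon).2 i
      simp only [map_add, map_smul, smul_eq_mul, map_sub, hpi] at this
      nlinarith [mul_pos hε (hzg i)]
  choose r hr hrz using key
  have hrlt : ∀ i, a (r i) z < β (r i) := fun i => by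
    have := hrz i
    rw [map_sub, hr] at this
    linarith
  have hinj : Function.Injective r := by
    intro i i' hii
    by_contra hne
    -- A shared inequality would be tight at the midpoint of `p i` and `p i'`. That midpoint
    -- satisfies every `g j` strictly, so it can be pushed further away from `z`, which violates the
    -- shared inequality.
    have hm : ∀ j, 0 < g j (p i + p i') := fun j => by
      rw [map_add]
      by_cases h : j = i
      · exact add_pos_of_nonneg_of_pos ((hpQ i).2 j) (hpg i' j (h ▸ hne))
      · exact add_pos_of_pos_of_nonneg (hpg i j h) ((hpQ i').2 j)
    have hmQ : (1 / 2 : ℝ) • (p i + p i') ∈ coneSlice s g :=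
      ⟨by simp [hp]; norm_num, fun j => by
        rw [map_smul]; exact smul_nonneg (by norm_num) (hm j).le⟩
    obtain ⟨ε, hε, h⟩ := exists_pos_add_smul_mem_coneSlice hmQ
      (v := (1 / 2 : ℝ) • (p i + p i') - z) (by simp [hp, hz]; norm_num)
      fun j => Or.inl (by rw [map_smul]; exact smul_pos (by norm_num) (hm j))
    have h1 := (hQ' _).2 h (r i)
    have h2 := hr i'
    rw [← hii] at h2
    simp only [map_add, map_smul, smul_eq_mul, map_sub, hr i, h2] at h1
    nlinarith [mul_pos hε (sub_pos.2 (hrlt i))]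
  obtain ⟨u, hu, hu'⟩ := exists_tight_of_forall_not_mem (v := z) ((hQ' _).2 hzQ)
    fun ε hε hcon => by
      have := ((hQ' _).1 hcon).1
      simp only [map_add, map_smul, smul_eq_mul, hz] at this
      linarith
  obtain ⟨w, hw, hw'⟩ := exists_tight_of_forall_not_mem (v := -z) ((hQ' _).2 hzQ)
    fun ε hε hcon => by
      have := ((hQ' _).1 hcon).1
      simp only [map_add, map_smul, smul_eq_mul, map_neg, hz] at this
      linarith
  have huw : u ≠ w := by
    rintro rfl
    rw [map_neg] at hw'
    linarith
  let F : Option (Option ι) → Fin m := fun o => o.elim u fun o => o.elim w r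
  have hF : Function.Injective F := by
    have h1 : ∀ i, r i ≠ u := fun i h => (hrlt i).ne (h ▸ hu)
    have h2 : ∀ i, r i ≠ w := fun i h => (hrlt i).ne (h ▸ hw)
    rintro (_ | _ | i) (_ | _ | j) h
    · rfl
    · exact absurd h huw
    · exact absurd h.symm (h1 j)
    · exact absurd h.symm huw
    · rfl
    · exact absurd h.symm (h2 j)
    · exact absurd h (h1 i)
    · exact absurd h (h2 i)
    · rw [hinj h]
  have := Fintype.card_le_of_injective F hF
  simp only [Fintype.card_option, Fintype.card_fin] at this
  omega

lemma polySize_coneSlice [Fintype ι] (H : Irredundant s g) :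
    polySize (coneSlice s g) = Fintype.card ι + 2 := by
  have hmem : Fintype.card ι + 2 ∈ {m : ℕ | ∃ (a : Fin m → Module.Dual ℝ V) (β : Fin m → ℝ),
      coneSlice s g = {x | ∀ i, a i x ≤ β i}} := by
    let e : Fin (Fintype.card ι + 2) ≃ Option (Option ι) :=
      (Fintype.equivFinOfCardEq (by simp)).symm
    refine ⟨fun i => (e i).elim s fun o => o.elim (-s) fun i => -g i,
      fun i => (e i).elim 1 fun o => o.elim (-1) fun _ => 0, ?_⟩
    ext x
    simp only [coneSlice, Set.mem_ofPred_eq]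
    rw [e.forall_congr_left]
    simp [Option.forall, le_antisymm_iff, and_assoc]
  refine le_antisymm (Nat.sInf_le hmem) (le_csInf ⟨_, hmem⟩ ?_)
  rintro m ⟨a, β, h⟩
  exact card_add_two_le H h

end Polyhedra


/-! ### Bit changes in a Gray code -/

section Codes

variable {n k : ℕ} {hn : 0 < n} {h : Fin n → Fin k → ℝ}

/-- An encoding with the fewest possible bits in which consecutive vectors differ in one bit. The
number of bits is a free parameter. -/
structure IsTightGray (h : Fin n → Fin k → ℝ) : Prop where
  isEncoding : IsEncoding h
  sum_abs_sub : ∀ (i : ℕ) (hi : i + 1 < n), ∑ l, |h ⟨i, by omega⟩ l - h ⟨i + 1, hi⟩ l| = 1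
  pow_lt : 0 < k → 2 ^ (k - 1) < n

/-- The guard `0 < k` excludes `n = 1`, where `2 ^ (k - 1) < n` fails because `k - 1` truncates to
zero. -/
lemma IsGrayCode.isTightGray {h : Fin n → Fin (Nat.clog 2 n) → ℝ} (H : IsGrayCode h) :
    IsTightGray h :=
  ⟨H.1, H.2, fun hk => Nat.pow_pred_clog_lt_self one_lt_two (by
    by_contra hn
    rw [Nat.clog_of_right_le_one (by omega)] at hk
    omega)⟩

lemma code_add_one (hn : 0 < n) (h : Fin n → Fin k → ℝ) (i : Fin n) :
    code hn h (i + 1) = h i := by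
  have := i.isLt
  unfold code
  congr 1
  ext
  simp only
  omega

lemma step_apply (i : ℕ) (l : Fin k) :
    step hn h i l = code hn h (i + 1) l - code hn h i l := rfl

lemma step_eq_zero {i : ℕ} (hi : i = 0 ∨ n ≤ i) : step hn h i = 0 := by
  have : code hn h (i + 1) = code hn h i := by
    unfold code
    congr 2
    omega
  rw [step, this, sub_self]

lemma one_le_of_step_ne_zero {i : ℕ} {l : Fin k} (h' : step hn h i l ≠ 0) : 1 ≤ i ∧ i < n := by
  by_contra hc
  exact h' (by rw [step_eq_zero (by omega)]; rfl)

lemma code_eq_of_step_eq_zero {a b : ℕ} {l : Fin k} (hab : a ≤ b)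
    (hs : ∀ i, a ≤ i → i < b → step hn h i l = 0) : code hn h b l = code hn h a l := by
  induction b, hab using Nat.le_induction with
  | base => rfl
  | succ b hab ih =>
    rw [← ih fun i h1 h2 => hs i h1 (by omega)]
    exact sub_eq_zero.1 (hs b hab (by omega))

variable (hn) (h) in
/-- The positions at which a bit changes that does not change anywhere else. -/
def essential : Set ℕ := {i | ∃ l, step hn h i l ≠ 0 ∧ ∀ i', i' ≠ i → step hn h i' l = 0}

lemma essential_subset : essential hn h ⊆ Set.Icc 1 (n - 1) := by
  rintro i ⟨l, hl, -⟩
  have := one_le_of_step_ne_zero hl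
  exact ⟨this.1, by omega⟩

namespace IsTightGray

lemma code_eq (H : IsTightGray h) (m : ℕ) (l : Fin k) : code hn h m l = 0 ∨ code hn h m l = 1 :=
  H.isEncoding.1 _ _

lemma sum_abs_step (H : IsTightGray h) {i : ℕ} (h1 : 1 ≤ i) (h2 : i < n) :
    ∑ l, |step hn h i l| = 1 := by
  obtain ⟨i, rfl⟩ : ∃ i', i = i' + 1 := ⟨i - 1, by omega⟩
  rw [← H.sum_abs_sub i h2]
  refine Finset.sum_congr rfl fun l _ => ?_
  rw [abs_sub_comm, step_apply]
  congr 2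
  · exact congrFun (code_add_one hn h ⟨i + 1, h2⟩) l
  · exact congrFun (code_add_one hn h ⟨i, by omega⟩) l

lemma abs_step_eq_one (H : IsTightGray h) {i : ℕ} {l : Fin k} (h' : step hn h i l ≠ 0) :
    |step hn h i l| = 1 := by
  rw [step_apply] at *
  rcases H.code_eq (hn := hn) (i + 1) l with h1 | h1 <;>
    rcases H.code_eq (hn := hn) i l with h2 | h2 <;> simp [h1, h2] at h' ⊢

lemma eq_of_step_ne_zero (H : IsTightGray h) {i : ℕ} {l l' : Fin k} (h1 : step hn h i l ≠ 0)
    (h2 : step hn h i l' ≠ 0) : l = l' := by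
  by_contra hne
  obtain ⟨ha, hb⟩ := one_le_of_step_ne_zero h1
  have h3 := H.sum_abs_step (hn := hn) ha hb
  have h4 := Finset.sum_le_sum_of_subset_of_nonneg (Finset.subset_univ {l, l'})
    (f := fun l => |step hn h i l|) fun _ _ _ => abs_nonneg _
  rw [Finset.sum_pair hne, H.abs_step_eq_one h1, H.abs_step_eq_one h2, h3] at h4
  norm_num at h4

/-- The vectors cannot be told apart by fewer than `k` binary tests. -/
lemma not_separated (H : IsTightGray h) (l₀ : Fin k) (f : Fin n → Fin k → Prop) :
    ¬ ∀ m m', (∀ l, l ≠ l₀ → (f m l ↔ f m' l)) → m = m' := by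
  classical
  intro hf
  have hinj : Function.Injective fun (m : Fin n) (l : {l // l ≠ l₀}) => f m l := by
    intro m m' hm
    exact hf m m' fun l hl => iff_of_eq (congrFun hm ⟨l, hl⟩)
  have := Fintype.card_le_of_injective _ hinj
  simp at this
  have h2 := H.pow_lt l₀.pos
  omega

lemma eq_of_forall_code_eq (H : IsTightGray h) {m m' : Fin n}
    (hm : ∀ l, code hn h (m + 1) l = code hn h (m' + 1) l) : m = m' :=
  H.isEncoding.2 (by rw [← code_add_one hn h, ← code_add_one hn h]; exact funext hm)

lemma code_eq_one_iff (H : IsTightGray h) {m m' : ℕ} {l : Fin k} :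
    (code hn h m l = 1 ↔ code hn h m' l = 1) ↔ code hn h m l = code hn h m' l := by
  rcases H.code_eq (hn := hn) m l with h1 | h1 <;>
    rcases H.code_eq (hn := hn) m' l with h2 | h2 <;> simp [h1, h2]

/-- Every bit changes somewhere. -/
lemma exists_index_step_ne_zero (H : IsTightGray h) (l : Fin k) : ∃ i, step hn h i l ≠ 0 := by
  by_contra! hc
  refine H.not_separated l (fun m l => code hn h (m + 1) l = 1) fun m m' hm =>
    H.eq_of_forall_code_eq (hn := hn) fun l' => ?_
  by_cases hl : l' = l
  · have h0 : ∀ a, code hn h a l = code hn h 0 l := fun a =>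
      code_eq_of_step_eq_zero (Nat.zero_le a) fun i _ _ => hc i
    rw [hl, h0, h0 (m' + 1)]
  · exact H.code_eq_one_iff.1 (hm l' hl)

/-- A bit that changes only once tells the vectors before the change from those after it. -/
lemma code_eq_iff_of_unique {i : ℕ} {l : Fin k} (h1 : step hn h i l ≠ 0)
    (h2 : ∀ i', i' ≠ i → step hn h i' l = 0) (m m' : ℕ) :
    code hn h m l = code hn h m' l ↔ (m ≤ i ↔ m' ≤ i) := by
  have hle : ∀ a, a ≤ i → code hn h a l = code hn h i l := fun a ha =>
    (code_eq_of_step_eq_zero ha fun j _ hj => h2 j hj.ne).symm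
  have hlt : ∀ a, ¬ a ≤ i → code hn h a l = code hn h (i + 1) l := fun a ha =>
    code_eq_of_step_eq_zero (by omega) fun j hj _ => h2 j (by omega)
  have hne : code hn h (i + 1) l ≠ code hn h i l := sub_ne_zero.1 h1
  by_cases ha : m ≤ i <;> by_cases hb : m' ≤ i
  · simp [ha, hb, hle]
  · simp [ha, hb, hle m ha, hlt m' hb, hne.symm]
  · simp [ha, hb, hle m' hb, hlt m ha, hne]
  · simp [ha, hb, hlt]

/-- Three bits that change once each only tell which of the four intervals cut out by `i₁ < i₂ < i₃`
contains a position. Two binary tests give the same information, so `k - 1` tests would separate all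
the vectors. -/
lemma not_three_essential (H : IsTightGray h) {i₁ i₂ i₃ : ℕ} (h₁ : i₁ ∈ essential hn h)
    (h₂ : i₂ ∈ essential hn h) (h₃ : i₃ ∈ essential hn h) (h12 : i₁ < i₂) (h23 : i₂ < i₃) :
    False := by
  obtain ⟨l₁, hl₁, hu₁⟩ := h₁
  obtain ⟨l₂, hl₂, hu₂⟩ := h₂
  obtain ⟨l₃, hl₃, hu₃⟩ := h₃
  have hne21 : l₂ ≠ l₁ := fun h => hl₁ (h ▸ hu₂ i₁ h12.ne)
  have hne23 : l₂ ≠ l₃ := fun h => hl₂ (h ▸ hu₃ i₂ h23.ne)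
  have hne31 : l₃ ≠ l₁ := fun h => hl₁ (h ▸ hu₃ i₁ (h12.trans h23).ne)
  refine H.not_separated l₁
    -- Bit `l₁` is dropped, and bit `l₃` is replaced by the test whether the position is in the two
    -- middle intervals; bit `l₂` tells left from right.
    (fun m l => if l = l₃ then i₁ < (m : ℕ) + 1 ∧ (m : ℕ) + 1 ≤ i₃ else code hn h (m + 1) l = 1)
    fun m m' hm => H.eq_of_forall_code_eq (hn := hn) fun l => ?_
  have e2 := hm l₂ hne21
  have e3 := hm l₃ hne31
  simp only [hne23, if_false, if_true] at e2 e3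
  rw [H.code_eq_one_iff, code_eq_iff_of_unique hl₂ hu₂] at e2
  by_cases hc1 : l = l₁
  · rw [hc1, code_eq_iff_of_unique hl₁ hu₁]
    omega
  by_cases hc3 : l = l₃
  · rw [hc3, code_eq_iff_of_unique hl₃ hu₃]
    omega
  have := hm l hc1
  simp only [hc3, if_false] at this
  exact H.code_eq_one_iff.1 this

lemma ncard_essential_le (H : IsTightGray h) : (essential hn h).ncard ≤ 2 := by
  by_contra! hc
  rw [Set.two_lt_ncard_iff ((Set.finite_Icc _ _).subset essential_subset)] at hc
  obtain ⟨a, b, c, ha, hb, hc, hab, hac, hbc⟩ := hc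
  rcases hab.lt_or_gt with h1 | h1 <;> rcases hac.lt_or_gt with h2 | h2 <;>
    rcases hbc.lt_or_gt with h3 | h3
  · exact H.not_three_essential ha hb hc h1 h3
  · exact H.not_three_essential ha hc hb h2 h3
  · omega
  · exact H.not_three_essential hc ha hb h2 h1
  · exact H.not_three_essential hb ha hc h1 h2
  · omega
  · exact H.not_three_essential hb hc ha h3 h2
  · exact H.not_three_essential hc hb ha h3 h1

lemma single_mem (H : IsTightGray h) {W : Submodule ℝ (Fin k → ℝ)} {i : ℕ} {l : Fin k}
    (hi : step hn h i l ≠ 0) (hW : step hn h i ∈ W) : Pi.single l 1 ∈ W := by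
  have : (Pi.single l 1 : Fin k → ℝ) = (step hn h i l)⁻¹ • step hn h i := by
    ext l'
    by_cases hl : l' = l
    · subst hl
      simp [hi]
    · have : step hn h i l' = 0 := by
        by_contra h0
        exact hl (H.eq_of_step_ne_zero h0 hi)
      simp [hl, this]
  rw [this]
  exact W.smul_mem _ hW

lemma eq_top_of_forall_single_mem {W : Submodule ℝ (Fin k → ℝ)}
    (hW : ∀ l, Pi.single l 1 ∈ W) : W = ⊤ := by
  rw [eq_top_iff, ← (Pi.basisFun ℝ (Fin k)).span_eq, Submodule.span_le]
  rintro _ ⟨l, rfl⟩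
  simpa using hW l

lemma encSpace_eq_top (H : IsTightGray h) : encSpace h = ⊤ := by
  -- An empty family is only possible without bits, and then the ambient space is trivial.
  have hn : 0 < n ∨ k = 0 := by
    by_contra! hc
    exact absurd (H.pow_lt (by omega)) (by simp [Nat.le_zero.1 hc.1])
  rcases hn with hn | rfl
  · refine eq_top_of_forall_single_mem fun l => ?_
    obtain ⟨i, hi⟩ := H.exists_index_step_ne_zero (hn := hn) l
    exact H.single_mem hi (vsub_mem_vectorSpan ℝ (Set.mem_range_self _) (Set.mem_range_self _))
  · exact Subsingleton.elim _ _

/-- A bit left unchanged on `I` confines the span to a coordinate hyperplane; a bit that changes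
contributes its unit vector. -/
lemma span_step_eq_top_iff (H : IsTightGray h) (I : Set ℕ) :
    Submodule.span ℝ (step hn h '' I) = ⊤ ↔ ∀ l, ∃ i ∈ I, step hn h i l ≠ 0 := by
  refine ⟨fun hI l => ?_, fun hI => eq_top_of_forall_single_mem fun l => ?_⟩
  · by_contra! hc
    have hle : Submodule.span ℝ (step hn h '' I) ≤ LinearMap.ker (LinearMap.proj l) := by
      rw [Submodule.span_le]
      rintro _ ⟨i, hi, rfl⟩
      exact hc i hi
    rw [hI] at hle
    simpa using hle (Submodule.mem_top (x := Pi.single l 1))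
  · obtain ⟨i, hi, hl⟩ := hI l
    exact H.single_mem hl (Submodule.subset_span ⟨i, hi, rfl⟩)

/-- The spanned hyperplanes are the coordinate hyperplanes. -/
lemma spannedHyperplanes_eq (H : IsTightGray h) :
    spannedHyperplanes hn h =
      Set.range fun l : Fin k => LinearMap.ker (LinearMap.proj l : (Fin k → ℝ) →ₗ[ℝ] ℝ) := by
  have hrank : ∀ l : Fin k, Module.finrank ℝ
      (LinearMap.ker (LinearMap.proj l : (Fin k → ℝ) →ₗ[ℝ] ℝ)) + 1 = k := fun l => by
    have := finrank_inf_ker_add_one (S := ⊤)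
      (f := (LinearMap.proj l : (Fin k → ℝ) →ₗ[ℝ] ℝ)) (v := Pi.single l 1) trivial (by simp)
    rwa [top_inf_eq, finrank_top, Module.finrank_fin_fun] at this
  have hfin : Module.finrank ℝ (encSpace h) = k := by
    rw [H.encSpace_eq_top, finrank_top, Module.finrank_fin_fun]
  ext W
  simp only [spannedHyperplanes, Set.mem_ofPred_eq, hfin, H.encSpace_eq_top, Set.mem_range, le_top,
    true_and]
  constructor
  · rintro ⟨hW, I, -, rfl⟩
    have hne : Submodule.span ℝ (step hn h '' I) ≠ ⊤ := by
      intro hc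
      rw [hc, finrank_top, Module.finrank_fin_fun] at hW
      omega
    rw [Ne, H.span_step_eq_top_iff] at hne
    push Not at hne
    obtain ⟨l, hl⟩ := hne
    refine ⟨l, (Submodule.eq_of_le_of_finrank_eq ?_ ?_).symm⟩
    · rw [Submodule.span_le]
      rintro _ ⟨i, hi, rfl⟩
      exact hl i hi
    · have := hrank l
      omega
  · rintro ⟨l, rfl⟩
    -- The positions where bit `l` stays fixed include every change of every other bit, since only
    -- one bit changes at a time.
    refine ⟨hrank l, {i | step hn h i l = 0} ∩ Set.Icc 1 (n - 1), Set.inter_subset_right, ?_⟩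
    refine le_antisymm (fun v hv => ?_) ?_
    · rw [pi_eq_sum_univ' v]
      refine Submodule.sum_mem _ fun l' _ => ?_
      by_cases hl : l' = l
      · rw [hl, show v l = 0 from hv, zero_smul]
        exact Submodule.zero_mem _
      · obtain ⟨i, hi⟩ := H.exists_index_step_ne_zero (hn := hn) l'
        have hr := one_le_of_step_ne_zero hi
        refine Submodule.smul_mem _ _ ?_
        have := H.single_mem (W := Submodule.span ℝ
          (step hn h '' ({i | step hn h i l = 0} ∩ Set.Icc 1 (n - 1)))) hi
          (Submodule.subset_span ⟨i, ⟨?_, hr.1, by omega⟩, rfl⟩)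
        · exact this
        · by_contra h0
          exact hl (H.eq_of_step_ne_zero hi h0)
    · rw [Submodule.span_le]
      rintro _ ⟨i, hi, rfl⟩
      exact hi.1

lemma sizeG_eq (H : IsTightGray h) : sizeG hn h = 2 * k := by
  rw [sizeG, H.spannedHyperplanes_eq, ← Set.image_univ, Set.ncard_image_of_injective,
    Set.ncard_univ, Nat.card_eq_fintype_card, Fintype.card_fin]
  intro l l' hl
  by_contra hne
  have h1 : (Pi.single l 1 : Fin k → ℝ) ∈
      LinearMap.ker (LinearMap.proj l' : (Fin k → ℝ) →ₗ[ℝ] ℝ) := by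
    simp [Ne.symm hne]
  simp only at hl
  rw [← hl] at h1
  simp at h1

/-- Removing one step destroys the span exactly when it is the only change of some bit. The ends `1`
and `n + 1` need no special case: at positions `0` and `n` the step is zero, so they are never
essential. -/
lemma mem_boundIndices_iff (H : IsTightGray h) {j : ℕ} :
    j ∈ boundIndices hn h ↔ j ∈ Set.Icc 1 (n + 1) ∧ j - 1 ∉ essential hn h := by
  have hnot : ∀ j, ¬ (1 ≤ j ∧ j < n) → j ∉ essential hn h := fun j hj he => by
    have := essential_subset he
    exact hj ⟨this.1, by have := this.2; omega⟩
  have hspan : encSpace h = Submodule.span ℝ (step hn h '' (Set.Icc 1 (n - 1) \ {j - 1})) ↔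
      j - 1 ∉ essential hn h := by
    rw [H.encSpace_eq_top, eq_comm, H.span_step_eq_top_iff]
    constructor
    · rintro hs ⟨l, hl, hu⟩
      obtain ⟨i, hi, hne⟩ := hs l
      exact hne (hu i hi.2)
    · intro he l
      by_contra! hc
      obtain ⟨i, hi⟩ := H.exists_index_step_ne_zero (hn := hn) l
      have hall : ∀ i', i' ≠ j - 1 → step hn h i' l = 0 := fun i' hne => by
        by_contra h0
        have hr := one_le_of_step_ne_zero h0
        exact h0 (hc i' ⟨⟨hr.1, by omega⟩, hne⟩)
      have hij : i = j - 1 := by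
        by_contra hne
        exact hi (hall i hne)
      exact he ⟨l, hij ▸ hi, hall⟩
  simp only [boundIndices, Set.mem_union, Set.mem_insert_iff, Set.mem_singleton_iff,
    Set.mem_ofPred_eq, Set.mem_Icc, hspan]
  constructor
  · rintro ((rfl | rfl) | ⟨h1, h2⟩)
    · exact ⟨by omega, hnot _ (by omega)⟩
    · exact ⟨by omega, hnot _ (by omega)⟩
    · exact ⟨by omega, h2⟩
  · rintro ⟨h1, h2⟩
    by_cases hj : j = 1 ∨ j = n + 1
    · exact Or.inl hj
    · exact Or.inr ⟨by omega, h2⟩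

lemma sizeB_add_ncard_essential (H : IsTightGray h) :
    sizeB hn h + (essential hn h).ncard = n + 1 := by
  have hsub : (fun i => i + 1) '' essential hn h ⊆ Set.Icc 1 (n + 1) := by
    rintro _ ⟨i, hi, rfl⟩
    have := (essential_subset hi).2
    simp only [Set.mem_Icc]
    omega
  have heq : boundIndices hn h = Set.Icc 1 (n + 1) \ (fun i => i + 1) '' essential hn h := by
    ext j
    rw [H.mem_boundIndices_iff, Set.mem_sdiff]
    refine and_congr_right fun hj => not_congr ⟨fun h => ⟨j - 1, h, ?_⟩, ?_⟩
    · have := hj.1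
      simp only
      omega
    · rintro ⟨i, hi, rfl⟩
      exact hi
  rw [sizeB, heq, ← Set.ncard_image_of_injective (essential hn h) (add_left_injective 1),
    Set.ncard_sdiff_add_ncard_of_subset hsub (Set.finite_Icc _ _)]
  simp

end IsTightGray

end Codes


/-! ### The inequality description of the embedding and its facets -/

section Description

variable {n k : ℕ}

/-- The linear form `∑ j, λ_j`. -/
def sumForm (n k : ℕ) : Module.Dual ℝ ((Fin (n + 1) → ℝ) × (Fin k → ℝ)) :=
  (∑ j, LinearMap.proj j) ∘ₗ LinearMap.fst ℝ _ _

/-- The linear form `λ_j`. -/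
def varForm (k : ℕ) (j : Fin (n + 1)) : Module.Dual ℝ ((Fin (n + 1) → ℝ) × (Fin k → ℝ)) :=
  LinearMap.proj j ∘ₗ LinearMap.fst ℝ _ _

/-- The linear form `y_l - ∑ j, min {h^j_l, h^{j-1}_l} λ_j`. -/
def lowerForm (hn : 0 < n) (h : Fin n → Fin k → ℝ) (l : Fin k) :
    Module.Dual ℝ ((Fin (n + 1) → ℝ) × (Fin k → ℝ)) :=
  LinearMap.proj l ∘ₗ LinearMap.snd ℝ _ _ -
    (∑ j : Fin (n + 1), min (code hn h (j + 1) l) (code hn h j l) • LinearMap.proj j) ∘ₗ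
      LinearMap.fst ℝ _ _

/-- The linear form `∑ j, max {h^j_l, h^{j-1}_l} λ_j - y_l`. -/
def upperForm (hn : 0 < n) (h : Fin n → Fin k → ℝ) (l : Fin k) :
    Module.Dual ℝ ((Fin (n + 1) → ℝ) × (Fin k → ℝ)) :=
  (∑ j : Fin (n + 1), max (code hn h (j + 1) l) (code hn h j l) • LinearMap.proj j) ∘ₗ
      LinearMap.fst ℝ _ _ - LinearMap.proj l ∘ₗ LinearMap.snd ℝ _ _

lemma sumForm_apply (x : (Fin (n + 1) → ℝ) × (Fin k → ℝ)) : sumForm n k x = ∑ j, x.1 j := by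
  simp [sumForm]

lemma varForm_apply (j : Fin (n + 1)) (x : (Fin (n + 1) → ℝ) × (Fin k → ℝ)) :
    varForm k j x = x.1 j := rfl

variable {hn : 0 < n} {h : Fin n → Fin k → ℝ}

lemma lowerForm_apply (l : Fin k) (x : (Fin (n + 1) → ℝ) × (Fin k → ℝ)) :
    lowerForm hn h l x =
      x.2 l - ∑ j : Fin (n + 1), min (code hn h (j + 1) l) (code hn h j l) * x.1 j := by
  simp [lowerForm]

lemma upperForm_apply (l : Fin k) (x : (Fin (n + 1) → ℝ) × (Fin k → ℝ)) :
    upperForm hn h l x =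
      ∑ j : Fin (n + 1), max (code hn h (j + 1) l) (code hn h j l) * x.1 j - x.2 l := by
  simp [upperForm]

lemma lowerForm_add_upperForm (l : Fin k) (x : (Fin (n + 1) → ℝ) × (Fin k → ℝ)) :
    lowerForm hn h l x + upperForm hn h l x = ∑ j : Fin (n + 1), |step hn h j l| * x.1 j := by
  rw [lowerForm_apply, upperForm_apply, add_comm, sub_add_sub_cancel, ← Finset.sum_sub_distrib]
  refine Finset.sum_congr rfl fun j _ => ?_
  rw [← sub_mul, max_sub_min_eq_abs, abs_sub_comm, step_apply, abs_sub_comm]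

/-- The point over `λ` that divides the interval between the bounds on each `y_l` in the ratio
`θ_l : 1 - θ_l`. -/
def mixPoint (hn : 0 < n) (h : Fin n → Fin k → ℝ) (lam : Fin (n + 1) → ℝ) (θ : Fin k → ℝ) :
    (Fin (n + 1) → ℝ) × (Fin k → ℝ) :=
  (lam, fun l => ∑ j : Fin (n + 1),
    (min (code hn h (j + 1) l) (code hn h j l) + θ l * |step hn h j l|) * lam j)

lemma lowerForm_mixPoint (lam : Fin (n + 1) → ℝ) (θ : Fin k → ℝ) (l : Fin k) :
    lowerForm hn h l (mixPoint hn h lam θ) =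
      θ l * ∑ j : Fin (n + 1), |step hn h j l| * lam j := by
  rw [lowerForm_apply, mixPoint, ← Finset.sum_sub_distrib, Finset.mul_sum]
  exact Finset.sum_congr rfl fun j _ => by ring

lemma upperForm_mixPoint (lam : Fin (n + 1) → ℝ) (θ : Fin k → ℝ) (l : Fin k) :
    upperForm hn h l (mixPoint hn h lam θ) =
      (1 - θ l) * ∑ j : Fin (n + 1), |step hn h j l| * lam j := by
  have h1 := lowerForm_add_upperForm (hn := hn) (h := h) l (mixPoint hn h lam θ)
  rw [lowerForm_mixPoint] at h1
  rw [sub_mul, one_mul]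
  exact eq_sub_of_add_eq' h1

/-- All inequalities of the description. -/
def allForms (hn : 0 < n) (h : Fin n → Fin k → ℝ) :
    Fin k ⊕ Fin k ⊕ Fin (n + 1) → Module.Dual ℝ ((Fin (n + 1) → ℝ) × (Fin k → ℝ)) :=
  Sum.elim (lowerForm hn h) (Sum.elim (upperForm hn h) (varForm k))

/-- The inequalities of the description without the redundant variable bounds. -/
def facetForms (hn : 0 < n) (h : Fin n → Fin k → ℝ) :
    Fin k ⊕ Fin k ⊕ {j : Fin (n + 1) // (j : ℕ) ∉ essential hn h} →
      Module.Dual ℝ ((Fin (n + 1) → ℝ) × (Fin k → ℝ)) :=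
  Sum.elim (lowerForm hn h) (Sum.elim (upperForm hn h) fun j => varForm k j.1)

lemma mem_coneSlice_allForms {x : (Fin (n + 1) → ℝ) × (Fin k → ℝ)} :
    x ∈ coneSlice (sumForm n k) (allForms hn h) ↔
      ∑ j, x.1 j = 1 ∧ (∀ l, 0 ≤ lowerForm hn h l x ∧ 0 ≤ upperForm hn h l x) ∧
        ∀ j, 0 ≤ x.1 j := by
  change _ ∧ _ ↔ _
  simp [allForms, Sum.forall, sumForm_apply, varForm_apply, forall_and, and_assoc]

lemma convex_coneSlice {V ι : Type*} [AddCommGroup V] [Module ℝ V] (s : Module.Dual ℝ V)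
    (g : ι → Module.Dual ℝ V) : Convex ℝ (coneSlice s g) := by
  intro x hx y hy a b ha hb hab
  refine ⟨by simp [hx.1, hy.1, hab], fun i => ?_⟩
  simpa using add_nonneg (mul_nonneg ha (hx.2 i)) (mul_nonneg hb (hy.2 i))

/-- On the `i`-th piece `y_l = ∑ j, h i l * λ_j`, and at both positions where `λ` may be nonzero `h
i` is one of the two code vectors in the minimum and maximum. -/
lemma embedding_subset : embedding (sos2 n) h ⊆ coneSlice (sumForm n k) (allForms hn h) := by
  refine convexHull_min (Set.iUnion_subset fun i => ?_) (convex_coneSlice _ _)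
  rintro ⟨lam, y⟩ ⟨⟨⟨h0, h1⟩, hz⟩, rfl : y = h i⟩
  have hzero : ∀ j, j ≠ i.castSucc → j ≠ i.succ → lam j = 0 := fun j hj hj' =>
    le_antisymm (hz j hj hj') (h0 j)
  have hbd : ∀ j : Fin (n + 1), ∀ l,
      min (code hn h (j + 1) l) (code hn h j l) * lam j ≤ h i l * lam j ∧
      h i l * lam j ≤ max (code hn h (j + 1) l) (code hn h j l) * lam j := by
    intro j l
    by_cases hj : j = i.castSucc
    · subst hj
      rw [← code_add_one hn h i]
      exact ⟨mul_le_mul_of_nonneg_right (min_le_left _ _) (h0 _),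
        mul_le_mul_of_nonneg_right (le_max_left _ _) (h0 _)⟩
    by_cases hj' : j = i.succ
    · subst hj'
      rw [← code_add_one hn h i]
      exact ⟨mul_le_mul_of_nonneg_right (min_le_right _ _) (h0 _),
        mul_le_mul_of_nonneg_right (le_max_right _ _) (h0 _)⟩
    · simp [hzero j hj hj']
  have hsum : ∀ l, h i l = ∑ j, h i l * lam j := fun l => by rw [← Finset.mul_sum, h1, mul_one]
  refine mem_coneSlice_allForms.2 ⟨h1, fun l => ?_, h0⟩
  rw [lowerForm_apply, upperForm_apply, sub_nonneg, sub_nonneg]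
  exact ⟨(Finset.sum_le_sum fun j _ => (hbd j l).1).trans (hsum l).ge,
    (hsum l).le.trans (Finset.sum_le_sum fun j _ => (hbd j l).2)⟩

/-- An inner vertex of the simplex belongs to two consecutive pieces; at the two ends the constant
extension of the code makes both choices the same. -/
lemma single_code_mem (j : Fin (n + 1)) :
    ((Pi.single j 1, code hn h j) : (Fin (n + 1) → ℝ) × (Fin k → ℝ)) ∈ embedding (sos2 n) h ∧
    ((Pi.single j 1, code hn h (j + 1)) : (Fin (n + 1) → ℝ) × (Fin k → ℝ)) ∈
      embedding (sos2 n) h := by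
  have hj := j.isLt
  have key : ∀ i : Fin n, j = i.castSucc ∨ j = i.succ →
      ((Pi.single j 1, h i) : (Fin (n + 1) → ℝ) × (Fin k → ℝ)) ∈ embedding (sos2 n) h := by
    intro i hi
    refine subset_convexHull ℝ _ (Set.mem_iUnion.2 ⟨i, ⟨single_mem_stdSimplex ℝ j, ?_⟩, rfl⟩)
    intro j' h1 h2
    have : j' ≠ j := by
      rintro rfl
      exact hi.elim h1 h2
    simp [this]
  constructor
  · refine key _ ?_
    simp only [Fin.ext_iff, Fin.val_castSucc, Fin.val_succ]
    omega
  · refine key _ ?_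
    simp only [Fin.ext_iff, Fin.val_castSucc, Fin.val_succ]
    omega

namespace IsTightGray

/-- Consecutive vectors differ in one bit at most, so any choice of coordinates between them lies on
the segment that joins them. -/
lemma exists_segment (H : IsTightGray h) (j : ℕ) {θ : Fin k → ℝ} (hθ : ∀ l, θ l ∈ Set.Icc 0 1) :
    (fun l => min (code hn h (j + 1) l) (code hn h j l) + θ l * |step hn h j l|) ∈
      segment ℝ (code hn h j) (code hn h (j + 1)) := by
  by_cases hs : ∀ l, step hn h j l = 0
  · have he : code hn h (j + 1) = code hn h j := funext fun l => sub_eq_zero.1 (hs l)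
    simp [hs, he]
  push Not at hs
  obtain ⟨l₀, hl₀⟩ := hs
  have hother : ∀ l, l ≠ l₀ → step hn h j l = 0 := fun l hl => by
    by_contra h0
    exact hl (H.eq_of_step_ne_zero h0 hl₀)
  have hmem := hθ l₀
  rw [segment_eq_image]
  rcases lt_or_gt_of_ne (sub_ne_zero.1 hl₀) with hlt | hlt
  -- The bit drops here, so its minimum is at the far end of the segment and the ratio is reversed.
  · refine ⟨1 - θ l₀, ⟨by linarith [hmem.2], by linarith [hmem.1]⟩, funext fun l => ?_⟩
    by_cases hl : l = l₀
    · subst hl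
      simp only [Pi.add_apply, Pi.smul_apply, smul_eq_mul, step_apply, min_eq_left hlt.le,
        abs_of_neg (sub_neg.2 hlt)]
      ring
    · have he : code hn h (j + 1) l = code hn h j l := sub_eq_zero.1 (hother l hl)
      simp only [Pi.add_apply, Pi.smul_apply, smul_eq_mul, hother l hl, he, min_self, abs_zero]
      ring
  · refine ⟨θ l₀, hmem, funext fun l => ?_⟩
    by_cases hl : l = l₀
    · subst hl
      simp only [Pi.add_apply, Pi.smul_apply, smul_eq_mul, step_apply, min_eq_right hlt.le,
        abs_of_pos (sub_pos.2 hlt)]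
      ring
    · have he : code hn h (j + 1) l = code hn h j l := sub_eq_zero.1 (hother l hl)
      simp only [Pi.add_apply, Pi.smul_apply, smul_eq_mul, hother l hl, he, min_self, abs_zero]
      ring

lemma mixPoint_mem_embedding (H : IsTightGray h) {lam : Fin (n + 1) → ℝ} {θ : Fin k → ℝ}
    (h0 : ∀ j, 0 ≤ lam j) (h1 : ∑ j, lam j = 1) (hθ : ∀ l, θ l ∈ Set.Icc 0 1) :
    mixPoint hn h lam θ ∈ embedding (sos2 n) h := by
  have hconv : Convex ℝ (embedding (sos2 n) h) := convex_convexHull ℝ _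
  let z : Fin (n + 1) → (Fin (n + 1) → ℝ) × (Fin k → ℝ) := fun j =>
    (Pi.single j 1, fun l => min (code hn h (j + 1) l) (code hn h j l) + θ l * |step hn h j l|)
  have hz : ∀ j, z j ∈ embedding (sos2 n) h := by
    intro j
    obtain ⟨a, b, ha, hb, hab, hseg⟩ := H.exists_segment (hn := hn) j hθ
    have := hconv (single_code_mem (hn := hn) (h := h) j).1
      (single_code_mem (hn := hn) (h := h) j).2 ha hb hab
    convert this using 1
    refine Prod.ext ?_ hseg.symm
    simp only [z, Prod.fst_add, Prod.smul_fst]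
    rw [← add_smul, hab, one_smul]
  have hsum : mixPoint hn h lam θ = ∑ j, lam j • z j := by
    refine Prod.ext (funext fun j => ?_) (funext fun l => ?_)
    · simp [mixPoint, z, Prod.fst_sum, Finset.sum_apply, Pi.single_apply]
    · simp [mixPoint, z, Prod.snd_sum, Finset.sum_apply, mul_comm]
  rw [hsum]
  exact hconv.sum_mem (fun j _ => h0 j) h1 fun j _ => hz j

lemma exists_eq_mixPoint {x : (Fin (n + 1) → ℝ) × (Fin k → ℝ)}
    (hx : ∀ l, 0 ≤ lowerForm hn h l x ∧ 0 ≤ upperForm hn h l x) :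
    ∃ θ : Fin k → ℝ, (∀ l, θ l ∈ Set.Icc 0 1) ∧ x = mixPoint hn h x.1 θ := by
  set D : Fin k → ℝ := fun l => lowerForm hn h l x + upperForm hn h l x with hD
  have hD0 : ∀ l, 0 ≤ D l := fun l => add_nonneg (hx l).1 (hx l).2
  -- When `D l = 0` both slacks vanish, so the default value `0` of the quotient is harmless.
  refine ⟨fun l => lowerForm hn h l x / D l, fun l => ⟨div_nonneg (hx l).1 (hD0 l),
    div_le_one_of_le₀ (le_add_of_nonneg_right (hx l).2) (hD0 l)⟩, ?_⟩
  refine Prod.ext rfl (funext fun l => ?_)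
  have h1 := lowerForm_mixPoint (hn := hn) (h := h) x.1 (fun l => lowerForm hn h l x / D l) l
  rw [← lowerForm_add_upperForm, div_mul_cancel_of_imp
    (fun h0 => le_antisymm (by linarith [(hx l).2]) (hx l).1), lowerForm_apply,
    lowerForm_apply] at h1
  exact (sub_left_injective h1).symm

lemma embedding_eq (H : IsTightGray h) :
    embedding (sos2 n) h = coneSlice (sumForm n k) (allForms hn h) := by
  refine embedding_subset.antisymm fun x hx => ?_
  rw [mem_coneSlice_allForms] at hx
  obtain ⟨θ, hθ, he⟩ := exists_eq_mixPoint hx.2.1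
  rw [he]
  exact H.mixPoint_mem_embedding hx.2.2 hx.1 hθ

lemma sum_abs_step_mul_of_essential {j : Fin (n + 1)} {l : Fin k}
    (hu : ∀ i, i ≠ (j : ℕ) → step hn h i l = 0) (lam : Fin (n + 1) → ℝ) :
    ∑ i : Fin (n + 1), |step hn h i l| * lam i = |step hn h j l| * lam j := by
  refine Finset.sum_eq_single j (fun i _ hi => ?_) (by simp)
  rw [hu i (fun hc => hi (Fin.ext hc)), abs_zero, zero_mul]

/-- If bit `l` changes only at `j`, its two inequalities add up to `0 ≤ |step_j l| λ_j`, which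
implies the bound on `λ_j`. -/
lemma coneSlice_allForms_eq :
    coneSlice (sumForm n k) (allForms hn h) = coneSlice (sumForm n k) (facetForms hn h) := by
  ext x
  rw [mem_coneSlice_allForms]
  change _ ↔ _ ∧ _
  simp only [facetForms, Sum.forall, Sum.elim_inl, Sum.elim_inr, sumForm_apply, varForm_apply,
    Subtype.forall, forall_and, and_assoc]
  refine and_congr_right fun _ => and_congr_right fun h1 => and_congr_right fun h2 =>
    ⟨fun h3 j _ => h3 j, fun h3 j => ?_⟩
  by_cases hj : (j : ℕ) ∈ essential hn h
  · obtain ⟨l, hl, hu⟩ := hj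
    have := add_nonneg (h1 l) (h2 l)
    rw [lowerForm_add_upperForm, sum_abs_step_mul_of_essential hu] at this
    exact nonneg_of_mul_nonneg_right this (abs_pos.2 hl)
  · exact h3 j hj

lemma sum_abs_step_mul_pos {lam : Fin (n + 1) → ℝ} (h0 : ∀ j, 0 ≤ lam j) {l : Fin k}
    (hl : ∃ j : Fin (n + 1), step hn h j l ≠ 0 ∧ 0 < lam j) :
    0 < ∑ j : Fin (n + 1), |step hn h j l| * lam j := by
  obtain ⟨j, hj, hp⟩ := hl
  exact Finset.sum_pos' (fun i _ => mul_nonneg (abs_nonneg _) (h0 i))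
    ⟨j, Finset.mem_univ _, mul_pos (abs_pos.2 hj) hp⟩

/-- Uniform `λ` with all ratios `1 / 2` is strictly feasible. Setting a single ratio to `0` or `1`
makes just one lower or upper inequality tight. For a variable bound, the weight at `j` is set to
zero. -/
lemma irredundant (H : IsTightGray h) : Irredundant (sumForm n k) (facetForms hn h) := by
  have hn' : (0 : ℝ) < n := Nat.cast_pos.2 hn
  have hflip : ∀ l, ∃ j : Fin (n + 1), step hn h j l ≠ 0 := fun l => by
    obtain ⟨i, hi⟩ := H.exists_index_step_ne_zero (hn := hn) l
    exact ⟨⟨i, (one_le_of_step_ne_zero hi).2.trans (Nat.lt_succ_self n)⟩, hi⟩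
  let u : Fin (n + 1) → ℝ := fun _ => ((n : ℝ) + 1)⁻¹
  have hu : ∀ j, 0 < u j := fun _ => by positivity
  have hus : ∀ θ, sumForm n k (mixPoint hn h u θ) = 1 := fun θ => by
    simp only [sumForm_apply, mixPoint, u, Finset.sum_const, Finset.card_univ, Fintype.card_fin,
      nsmul_eq_mul]
    push_cast
    exact mul_inv_cancel₀ (by positivity)
  have huD : ∀ l, 0 < ∑ j : Fin (n + 1), |step hn h j l| * u j := fun l =>
    sum_abs_step_mul_pos (fun j => (hu j).le) ((hflip l).imp fun j hj => ⟨hj, hu j⟩)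
  refine ⟨⟨mixPoint hn h u fun _ => 1 / 2, hus _, ?_⟩, ?_⟩
  · rintro (l | l | j)
    · simpa [facetForms, lowerForm_mixPoint] using huD l
    · simp only [facetForms, Sum.elim_inr, Sum.elim_inl, upperForm_mixPoint]
      exact mul_pos (by norm_num) (huD l)
    · exact hu j
  · rintro (l | l | j)
    · refine ⟨mixPoint hn h u fun l' => if l' = l then 0 else 1 / 2, hus _, ?_, ?_⟩
      · simp [facetForms, lowerForm_mixPoint]
      · rintro (l' | l' | j) hne
        · have : l' ≠ l := fun hc => hne (hc ▸ rfl)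
          simpa [facetForms, lowerForm_mixPoint, this] using huD l'
        · simp only [facetForms, Sum.elim_inr, Sum.elim_inl, upperForm_mixPoint]
          exact mul_pos (by split_ifs <;> norm_num) (huD l')
        · exact hu j
    · refine ⟨mixPoint hn h u fun l' => if l' = l then 1 else 1 / 2, hus _, ?_, ?_⟩
      · simp [facetForms, upperForm_mixPoint]
      · rintro (l' | l' | j) hne
        · simp only [facetForms, Sum.elim_inl, lowerForm_mixPoint]
          exact mul_pos (by split_ifs <;> norm_num) (huD l')
        · have : l' ≠ l := fun hc => hne (hc ▸ rfl)
          simp only [facetForms, Sum.elim_inr, Sum.elim_inl, upperForm_mixPoint, this, if_false]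
          exact mul_pos (by norm_num) (huD l')
        · exact hu j
    · let w : Fin (n + 1) → ℝ := fun i => if i = j then 0 else (n : ℝ)⁻¹
      have hw : ∀ i, i ≠ j.1 → 0 < w i := fun i hi => by
        simp only [w, hi, if_false]
        positivity
      have hw0 : ∀ i, 0 ≤ w i := fun i => by
        simp only [w]
        split_ifs <;> positivity
      -- As `j` is not essential, each bit changes at some other position, so its interval keeps
      -- positive length.
      have hwD : ∀ l, 0 < ∑ i : Fin (n + 1), |step hn h i l| * w i := fun l => by
        refine sum_abs_step_mul_pos hw0 ?_
        by_contra! hc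
        have hz : ∀ i : Fin (n + 1), i ≠ j.1 → step hn h i l = 0 := fun i hi => by
          by_contra h0
          exact absurd (hw i hi) (hc i h0).not_gt
        obtain ⟨i, hi⟩ := hflip l
        have hij : i = j.1 := by
          by_contra h0
          exact hi (hz i h0)
        refine j.2 ⟨l, hij ▸ hi, fun i' hi' => ?_⟩
        by_contra h0
        exact h0 (hz ⟨i', (one_le_of_step_ne_zero h0).2.trans (Nat.lt_succ_self n)⟩
          fun hc => hi' (congrArg Fin.val hc))
      refine ⟨mixPoint hn h w fun _ => 1 / 2, ?_, ?_, ?_⟩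
      · simp only [sumForm_apply, mixPoint, w]
        rw [Finset.sum_ite, Finset.filter_ne']
        simp [hn'.ne']
      · simp [facetForms, varForm_apply, mixPoint, w]
      · rintro (l | l | i) hne
        · simpa [facetForms, lowerForm_mixPoint] using hwD l
        · simp only [facetForms, Sum.elim_inr, Sum.elim_inl, upperForm_mixPoint]
          exact mul_pos (by norm_num) (hwD l)
        · exact hw i fun hc => hne (by rw [Subtype.ext hc])

lemma facetDefining_lower (H : IsTightGray h) (l : Fin k) :
    FacetDefining (embedding (sos2 n) h)
      (fun p => ∑ j : Fin (n + 1), min (code hn h (j + 1) l) (code hn h j l) * p.1 j)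
      (fun p => p.2 l) := by
  rw [H.embedding_eq (hn := hn), coneSlice_allForms_eq]
  refine ⟨fun x hx => ?_, ?_⟩
  · have := hx.2 (Sum.inl l)
    rwa [facetForms, Sum.elim_inl, lowerForm_apply, sub_nonneg] at this
  · convert isFacet_coneSlice (H.irredundant (hn := hn)) (Sum.inl l) using 4 with x
    rw [facetForms, Sum.elim_inl, lowerForm_apply, sub_eq_zero, eq_comm]

lemma facetDefining_upper (H : IsTightGray h) (l : Fin k) :
    FacetDefining (embedding (sos2 n) h) (fun p => p.2 l)
      (fun p => ∑ j : Fin (n + 1), max (code hn h (j + 1) l) (code hn h j l) * p.1 j) := by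
  rw [H.embedding_eq (hn := hn), coneSlice_allForms_eq]
  refine ⟨fun x hx => ?_, ?_⟩
  · have := hx.2 (Sum.inr (Sum.inl l))
    rwa [facetForms, Sum.elim_inr, Sum.elim_inl, upperForm_apply, sub_nonneg] at this
  · convert isFacet_coneSlice (H.irredundant (hn := hn)) (Sum.inr (Sum.inl l)) using 4 with x
    rw [facetForms, Sum.elim_inr, Sum.elim_inl, upperForm_apply, sub_eq_zero, eq_comm]

lemma facetDefining_var_iff (H : IsTightGray h) (j : Fin (n + 1)) :
    FacetDefining (embedding (sos2 n) h) (fun _ => 0) (fun p => p.1 j) ↔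
      (j : ℕ) ∉ essential hn h := by
  constructor
  · rintro ⟨-, hF⟩ ⟨l, hl, hu⟩
    rw [H.embedding_eq (hn := hn)] at hF
    -- Only the polyhedron passes to the irredundant system; points of the face keep all
    -- inequalities. There `λ_j = 0` makes the two nonnegative slacks of bit `l` add up to zero, so
    -- both are tight.
    nth_rewrite 1 [coneSlice_allForms_eq] at hF
    refine not_isFacet_coneSlice (H.irredundant (hn := hn)) (i := Sum.inl l)
      (i' := Sum.inr (Sum.inl l)) (by simp) (fun x hx => ?_) hF
    obtain ⟨hx, hj : (0 : ℝ) = x.1 j⟩ := hx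
    have hx' := mem_coneSlice_allForms.1 hx
    have hD := lowerForm_add_upperForm (hn := hn) (h := h) l x
    rw [sum_abs_step_mul_of_essential hu, ← hj, mul_zero] at hD
    have := hx'.2.1 l
    refine ⟨hx.1, ?_, ?_⟩
    · change lowerForm hn h l x = 0
      linarith
    · change upperForm hn h l x = 0
      linarith
  · intro hj
    rw [H.embedding_eq (hn := hn), coneSlice_allForms_eq]
    refine ⟨fun x hx => hx.2 (Sum.inr (Sum.inr ⟨j, hj⟩)), ?_⟩
    convert isFacet_coneSlice (H.irredundant (hn := hn)) (Sum.inr (Sum.inr ⟨j, hj⟩)) using 4 with x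
    rw [eq_comm]
    rfl

lemma sizeB_eq_ncard (H : IsTightGray h) :
    sizeB hn h = {j : Fin (n + 1) |
      FacetDefining (embedding (sos2 n) h) (fun _ => 0) (fun p => p.1 j)}.ncard := by
  rw [sizeB, ← Set.ncard_image_of_injective _
    (f := fun j : Fin (n + 1) => (j : ℕ) + 1) fun a b hab => Fin.ext (Nat.succ_injective hab)]
  congr 1
  ext m
  simp only [H.facetDefining_var_iff (hn := hn), H.mem_boundIndices_iff, Set.mem_image,
    Set.mem_ofPred_eq, Set.mem_Icc]
  constructor
  · rintro ⟨h1, h2⟩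
    exact ⟨⟨m - 1, by omega⟩, h2, by simp only; omega⟩
  · rintro ⟨j, hj, rfl⟩
    have := j.isLt
    exact ⟨by omega, hj⟩

lemma polySize_eq (H : IsTightGray h) :
    polySize (embedding (sos2 n) h) = 2 * k + sizeB hn h + 2 := by
  classical
  have hcard : Fintype.card {j : Fin (n + 1) // (j : ℕ) ∉ essential hn h} = sizeB hn h := by
    rw [H.sizeB_eq_ncard, ← Nat.card_eq_fintype_card]
    simp only [H.facetDefining_var_iff (hn := hn)]
    rfl
  rw [H.embedding_eq (hn := hn), coneSlice_allForms_eq, polySize_coneSlice H.irredundant,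
    Fintype.card_sum, Fintype.card_sum, Fintype.card_fin, hcard]
  ring

end IsTightGray

end Description


/-! ### Extremal Gray codes -/

section Examples

variable {n k : ℕ}

/-- The real `0`-`1` vectors of a family of Boolean vectors. -/
def boolCode (v : Fin n → Fin k → Bool) (i : Fin n) (l : Fin k) : ℝ := if v i l then 1 else 0

lemma isEncoding_boolCode {v : Fin n → Fin k → Bool} (hv : Function.Injective v) :
    IsEncoding (boolCode v) := by
  refine ⟨fun i l => ?_, fun i j hij => hv (funext fun l => ?_)⟩
  · unfold boolCode
    split_ifs <;> simp
  · have := congrFun hij l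
    unfold boolCode at this
    cases h1 : v i l <;> cases h2 : v j l <;> simp [h1, h2] at this ⊢

lemma sum_abs_sub_boolCode (v : Fin n → Fin k → Bool) (i j : Fin n) :
    ∑ l, |boolCode v i l - boolCode v j l| = (Finset.univ.filter fun l => v i l ≠ v j l).card := by
  rw [Finset.card_filter, Nat.cast_sum]
  refine Finset.sum_congr rfl fun l _ => ?_
  unfold boolCode
  cases v i l <;> cases v j l <;> simp

lemma step_boolCode_ne_zero (hn : 0 < n) (v : Fin n → Fin k → Bool) (i : ℕ) (l : Fin k) :
    step hn (boolCode v) i l ≠ 0 ↔ code hn v (i + 1) l ≠ code hn v i l := by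
  rw [step_apply, sub_ne_zero]
  simp only [code, boolCode]
  generalize v _ l = a
  generalize v _ l = b
  cases a <;> cases b <;> simp

lemma step_boolCode_eq_zero (hn : 0 < n) (v : Fin n → Fin k → Bool) (i : ℕ) (l : Fin k) :
    step hn (boolCode v) i l = 0 ↔ code hn v (i + 1) l = code hn v i l :=
  not_iff_not.1 (step_boolCode_ne_zero hn v i l)

/-- A Gray code with three vectors, both bits of which change once. -/
lemma exists_isTightGray_three : ∃ h : Fin 3 → Fin 2 → ℝ, IsTightGray h ∧
    essential (by norm_num) h = {1, 2} := by
  let v : Fin 3 → Fin 2 → Bool := ![![false, false], ![false, true], ![true, true]]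
  have hn : 0 < 3 := by norm_num
  refine ⟨boolCode v, ⟨isEncoding_boolCode (by decide), fun i hi => ?_, fun _ => by norm_num⟩, ?_⟩
  · have : ∀ i : Fin 2, (Finset.univ.filter fun l => v i.castSucc l ≠ v i.succ l).card = 1 := by
      decide
    rw [sum_abs_sub_boolCode]
    exact_mod_cast this ⟨i, by omega⟩
  · refine Set.Subset.antisymm (fun i hi => ?_) ?_
    · obtain ⟨h1, h2⟩ := essential_subset hi
      simp only [Set.mem_insert_iff, Set.mem_singleton_iff]
      omega
    -- Outside `1, …, n - 1` all steps vanish, so a finite check suffices.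
    · have hd : ∀ i ∈ Finset.Icc 1 2, ∃ l, code hn v (i + 1) l ≠ code hn v i l ∧
          ∀ i' ∈ Finset.Icc 1 2, i' ≠ i → code hn v (i' + 1) l = code hn v i' l := by decide +revert
      intro i hi
      obtain ⟨l, hl, hu⟩ := hd i (by rcases hi with rfl | rfl <;> simp)
      refine ⟨l, (step_boolCode_ne_zero hn v i l).2 hl, fun i' hi' => ?_⟩
      by_contra h0
      obtain ⟨h1, h2⟩ := one_le_of_step_ne_zero h0
      exact h0 ((step_boolCode_eq_zero hn v i' l).2
        (hu i' (Finset.mem_Icc.2 ⟨h1, by omega⟩) hi'))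

/-- A Gray code with eight vectors, all bits of which change at least twice. -/
lemma exists_isTightGray_eight : ∃ h : Fin 8 → Fin 3 → ℝ, IsTightGray h ∧
    essential (by norm_num) h = ∅ := by
  -- The reflected code rotated cyclically by one place: its leading bit, which used to change once,
  -- now also changes at the former wrap-around.
  let v : Fin 8 → Fin 3 → Bool := ![![false, false, true], ![false, true, true],
    ![false, true, false], ![true, true, false], ![true, true, true], ![true, false, true],
    ![true, false, false], ![false, false, false]]
  have hn : 0 < 8 := by norm_num
  refine ⟨boolCode v, ⟨isEncoding_boolCode (by decide), fun i hi => ?_, fun _ => by norm_num⟩, ?_⟩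
  · have : ∀ i : Fin 7, (Finset.univ.filter fun l => v i.castSucc l ≠ v i.succ l).card = 1 := by
      decide
    rw [sum_abs_sub_boolCode]
    exact_mod_cast this ⟨i, by omega⟩
  · have hd : ∀ l, ∀ i < 8, code hn v (i + 1) l ≠ code hn v i l →
        ∃ i' < 8, i' ≠ i ∧ code hn v (i' + 1) l ≠ code hn v i' l := by decide +revert
    rw [Set.eq_empty_iff_forall_notMem]
    rintro i ⟨l, hl, hu⟩
    obtain ⟨i', -, hne, hi'⟩ := hd l i (one_le_of_step_ne_zero hl).2
      ((step_boolCode_ne_zero hn v i l).1 hl)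
    exact (step_boolCode_ne_zero hn v i' l).2 hi' (hu i' hne)

end Examples

lemma IsTightGray.isGrayCode {n : ℕ} {h : Fin n → Fin (Nat.clog 2 n) → ℝ} (H : IsTightGray h) :
    IsGrayCode h := ⟨H.1, H.2⟩

end EmbeddingForm

open EmbeddingForm

theorem corollary3 :
    (∀ (n : ℕ) (hn : 0 < n) (h : Fin n → Fin (Nat.clog 2 n) → ℝ), IsGrayCode h →
      -- the description of `Q(P, H)`; `j` is zero-based, so `h^j`, `h^{j-1}` of the usual numbering
      -- are `code hn h (j + 1)` and `code hn h j`
      (∀ (lam : Fin (n + 1) → ℝ) (y : Fin (Nat.clog 2 n) → ℝ),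
        (lam, y) ∈ embedding (sos2 n) h ↔
          ∑ j, lam j = 1 ∧
          (∀ l, ∑ j : Fin (n + 1), min (code hn h (j + 1) l) (code hn h j l) * lam j ≤ y l ∧
            y l ≤ ∑ j : Fin (n + 1), max (code hn h (j + 1) l) (code hn h j l) * lam j) ∧
          ∀ j, 0 ≤ lam j) ∧
      -- all general inequalities are facet defining
      (∀ l,
        FacetDefining (embedding (sos2 n) h)
          (fun p => ∑ j : Fin (n + 1), min (code hn h (j + 1) l) (code hn h j l) * p.1 j)
          (fun p => p.2 l) ∧
        FacetDefining (embedding (sos2 n) h)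
          (fun p => p.2 l)
          (fun p => ∑ j : Fin (n + 1), max (code hn h (j + 1) l) (code hn h j l) * p.1 j)) ∧
      sizeG hn h = 2 * Nat.clog 2 n ∧
      -- the facet defining variable bounds
      n - 1 ≤ {j : Fin (n + 1) |
        FacetDefining (embedding (sos2 n) h) (fun _ => 0) (fun p => p.1 j)}.ncard ∧
      sizeB hn h = {j : Fin (n + 1) |
        FacetDefining (embedding (sos2 n) h) (fun _ => 0) (fun p => p.1 j)}.ncard ∧
      -- the sizes
      polySize (embedding (sos2 n) h) =
        sizeG hn h + sizeB hn h +
          2 * (1 + (Nat.clog 2 n - Module.finrank ℝ (encSpace h))) ∧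
      |(sizeB hn h : ℤ) - n| ≤ 1 ∧
      |(polySize (embedding (sos2 n) h) : ℤ) - (2 * Nat.clog 2 n + n + 2)| ≤ 1) ∧
    -- both bounds are attained from above
    (∃ (n : ℕ) (hn : 0 < n) (h : Fin n → Fin (Nat.clog 2 n) → ℝ), 2 ≤ n ∧ IsGrayCode h ∧
      (sizeB hn h : ℤ) - n = 1 ∧
      (polySize (embedding (sos2 n) h) : ℤ) - (2 * Nat.clog 2 n + n + 2) = 1) ∧
    -- both bounds are attained from below
    (∃ (n : ℕ) (hn : 0 < n) (h : Fin n → Fin (Nat.clog 2 n) → ℝ), 2 ≤ n ∧ IsGrayCode h ∧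
      (sizeB hn h : ℤ) - n = -1 ∧
      (polySize (embedding (sos2 n) h) : ℤ) - (2 * Nat.clog 2 n + n + 2) = -1) := by
  refine ⟨fun n hn h hG => ?_, ?_, ?_⟩
  · have H := hG.isTightGray
    -- With at most two essential positions, `hB` and `hE` give both bounds by arithmetic; the
    -- dimension term vanishes because the encoding spans the whole space.
    have hB := H.sizeB_add_ncard_essential (hn := hn)
    have hE := H.ncard_essential_le (hn := hn)
    have hS := H.polySize_eq (hn := hn)
    refine ⟨fun lam y => ?_, fun l => ⟨H.facetDefining_lower l, H.facetDefining_upper l⟩,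
      H.sizeG_eq, ?_, H.sizeB_eq_ncard, ?_, ?_, ?_⟩
    · rw [H.embedding_eq (hn := hn), mem_coneSlice_allForms]
      simp only [lowerForm_apply, upperForm_apply, sub_nonneg]
    · rw [← H.sizeB_eq_ncard (hn := hn)]
      omega
    · rw [hS, H.sizeG_eq, H.encSpace_eq_top, finrank_top, Module.finrank_fin_fun]
      omega
    · rw [abs_le]
      omega
    · rw [abs_le]
      omega
  · obtain ⟨h, H, hE⟩ : ∃ h : Fin 8 → Fin (Nat.clog 2 8) → ℝ, IsTightGray h ∧
        essential (by norm_num) h = ∅ := by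
      rw [show Nat.clog 2 8 = 3 by decide]
      exact exists_isTightGray_eight
    have hn : 0 < 8 := by norm_num
    have hB := H.sizeB_add_ncard_essential (hn := hn)
    have hS := H.polySize_eq (hn := hn)
    rw [hE, Set.ncard_empty] at hB
    refine ⟨8, hn, h, by norm_num, H.isGrayCode, ?_, ?_⟩ <;> omega
  · obtain ⟨h, H, hE⟩ : ∃ h : Fin 3 → Fin (Nat.clog 2 3) → ℝ, IsTightGray h ∧
        essential (by norm_num) h = {1, 2} := by
      rw [show Nat.clog 2 3 = 2 by decide]
      exact exists_isTightGray_three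
    have hn : 0 < 3 := by norm_num
    have hB := H.sizeB_add_ncard_essential (hn := hn)
    have hS := H.polySize_eq (hn := hn)
    rw [hE, Set.ncard_pair (by norm_num)] at hB
    refine ⟨3, hn, h, by norm_num, H.isGrayCode, ?_, ?_⟩ <;> omega
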